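/- Let $K$ be a field, $n\in\{1,2,3,4,5,7,9,11\}$, $R=K[x_1,\dots,x_n]$ with the $\mathbb Z^n$-grading in which $\deg x_i=e_i$ is the $i$-th canonical basis vector, and let $m=(x_1,\dots,x_n)$. A Stanley decomposition of a $\mathbb Z^n$-graded $R$-module $M$ is a finite family $\mathcal D=(R_i,u_i)_{i\in I}$ in which each $u_i\in M$ is homogeneous, each $R_i\subseteq R$ is a $\mathbb Z^n$-graded $K$-algebra retract of $R$ with $R_i\cap\operatorname{Ann}(u_i)=0$, and $M=\bigoplus_{i\in I}R_iu_i$ as a graded $K$-vector space. Its Stanley depth is the depth (with respect to $m$) of the $R$-module $\bigoplus_{i\in I}R_iu_i$, where $R_iu_i\cong R_i$ is an $R$-module through the retraction $R\to R_i$. The Stanley depth $\operatorname{sdepth}_n(M)$ of $M\neq 0$ is the maximum of the Stanley depths of its Stanley decompositions, and $\operatorname{sdepth}_n(0)=\infty$. Then, for the natural $\mathbb Z^n$-gradings on $m$ and $R\oplus m$, the maxima defining $\operatorname{sdepth}_n(m)$ and $\operatorname{sdepth}_n(R\oplus m)$ exist and $$\operatorname{sdepth}_n(m)=\operatorname{sdepth}_n(R\oplus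 m).$$ -/

import Mathlib

open MvPolynomial

namespace StanleyDepth

universe u v

/-- The depth of an `S`-module `N` with respect to an ideal `J`: the supremum of the lengths of the
`N`-regular sequences contained in `J`. -/
noncomputable def moduleDepth {S : Type u} [CommRing S] (J : Ideal S)
    (N : Type v) [AddCommGroup N] [Module S N] : ℕ∞ :=
  sSup {d : ℕ∞ | ∃ rs : List S, (∀ r ∈ rs, r ∈ J) ∧ RingTheory.Sequence.IsRegular N rs ∧
    d = (rs.length : ℕ∞)}

/-- The `a`-th homogeneous component, `a ∈ ℤⁿ`, of `R = K[x₁, …, xₙ]` for the multigrading in which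
`xᵢ` has degree the `i`-th canonical basis vector. -/
noncomputable def multigrading (K : Type u) [Field K] (n : ℕ) (a : Fin n → ℤ) :
    Submodule K (MvPolynomial (Fin n) K) :=
  weightedHomogeneousSubmodule K (fun i : Fin n => (Pi.single i 1 : Fin n → ℤ)) a

/-- A `ℤⁿ`-graded `K`-algebra retract of `R = K[x₁, …, xₙ]`. It is given by the composite
`R → A → R` of the graded retraction with the graded inclusion, i.e. by an idempotent graded
`K`-algebra endomorphism of `R`; the retract itself is its range. -/
structure GradedRetract (K : Type u) [Field K] (n : ℕ) where
  proj : MvPolynomial (Fin n) K →ₐ[K] MvPolynomial (Fin n) K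
  proj_proj : ∀ f, proj (proj f) = proj f
  proj_mem : ∀ (a : Fin n → ℤ), ∀ f ∈ multigrading K n a, proj f ∈ multigrading K n a

namespace GradedRetract

variable {K : Type u} [Field K] {n : ℕ}

/-- The retract as a `K`-subalgebra of `R`. -/
noncomputable def subalgebra (A : GradedRetract K n) : Subalgebra K (MvPolynomial (Fin n) K) :=
  A.proj.range

/-- The retract `A` regarded as an `R`-module through the retraction `R → A`, that is with the
action `r • s = proj r * s` (in general not the multiplication of `R`, for which `A` need not be
stable). -/
def AsModule (A : GradedRetract K n) : Type u := A.proj.range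

noncomputable instance (A : GradedRetract K n) : AddCommGroup A.AsModule :=
  inferInstanceAs (AddCommGroup A.proj.range)

noncomputable instance (A : GradedRetract K n) : Module (MvPolynomial (Fin n) K) A.AsModule :=
  Module.compHom A.proj.range A.proj.rangeRestrict.toRingHom

end GradedRetract

section

variable {K : Type u} [Field K] {n : ℕ} {M : Type v} [AddCommGroup M]
  [Module (MvPolynomial (Fin n) K) M] [Module K M] [IsScalarTower K (MvPolynomial (Fin n) K) M]

/-- The `K`-subspace `A u = {r u | r ∈ A}` of `M`. -/
noncomputable def retractSpan (A : GradedRetract K n) (u : M) : Submodule K M :=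
  (Subalgebra.toSubmodule A.subalgebra).map
    ((LinearMap.toSpanSingleton (MvPolynomial (Fin n) K) M u).restrictScalars K)

/-- A Stanley decomposition of an `R`-module `M` with `ℤⁿ`-grading `𝓜`: a finite family
`(Rᵢ, uᵢ)` of `ℤⁿ`-graded retracts `Rᵢ` of `R` and homogeneous elements `uᵢ` of `M` with
`Rᵢ ∩ Ann(uᵢ) = 0` and `M = ⨁ Rᵢ uᵢ` as a (graded) `K`-vector space. -/
structure StanleyDecomposition (𝓜 : (Fin n → ℤ) → Submodule K M) where
  size : ℕ
  retract : Fin size → GradedRetract K n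
  gen : Fin size → M
  gen_homogeneous : ∀ i, ∃ a, gen i ∈ 𝓜 a
  ann_eq_zero : ∀ i, ∀ r ∈ (retract i).subalgebra, r • gen i = 0 → r = 0
  isInternal : DirectSum.IsInternal fun i => retractSpan (retract i) (gen i)

/-- The Stanley depth of a Stanley decomposition `(Rᵢ, uᵢ)`: the depth, with respect to the
maximal ideal `(x₁, …, xₙ)`, of the `R`-module `⨁ Rᵢ uᵢ`. Each `Rᵢ uᵢ` is isomorphic to `Rᵢ`
(as `Rᵢ ∩ Ann(uᵢ) = 0`) and is an `R`-module through the retraction `R → Rᵢ`. -/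
noncomputable def StanleyDecomposition.depth {𝓜 : (Fin n → ℤ) → Submodule K M}
    (D : StanleyDecomposition 𝓜) : ℕ∞ :=
  moduleDepth (idealOfVars (Fin n) K) (DirectSum (Fin D.size) fun i => (D.retract i).AsModule)

/-- The set of the Stanley depths of all Stanley decompositions of `M`. -/
def stanleyDepths (𝓜 : (Fin n → ℤ) → Submodule K M) : Set ℕ∞ :=
  Set.range fun D : StanleyDecomposition 𝓜 => D.depth

open Classical in
/-- The (`ℤⁿ`-graded) Stanley depth of `M`: the largest Stanley depth of a Stanley decomposition
of `M`, and `∞` if `M = 0`. -/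
noncomputable def sdepth (𝓜 : (Fin n → ℤ) → Submodule K M) : ℕ∞ :=
  if Subsingleton M then ⊤ else sSup (stanleyDepths 𝓜)

end

/-- The `ℤⁿ`-grading that the maximal ideal `m = (x₁, …, xₙ)` inherits from `R`. -/
noncomputable def maxIdealGrading (K : Type u) [Field K] (n : ℕ) (a : Fin n → ℤ) :
    Submodule K (idealOfVars (Fin n) K) :=
  (multigrading K n a).comap ((idealOfVars (Fin n) K).subtype.restrictScalars K)

/-- The `ℤⁿ`-grading of `R ⊕ m`. -/
noncomputable def directSumGrading (K : Type u) [Field K] (n : ℕ) (a : Fin n → ℤ) :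
    Submodule K (MvPolynomial (Fin n) K × idealOfVars (Fin n) K) :=
  (multigrading K n a).prod (maxIdealGrading K n a)

end StanleyDepth

/-!
Both Stanley depths equal `⌈n / 2⌉`.

Upper bound: a decomposition of `R ⊕ m` is compared with the Hilbert series of `R ⊕ m` up to `t²`.
It has exactly one generator of degree `0`, with `z` free variables say, and hence `2 n - z`
generators of degree `1`. If every summand has at least `d` free variables, the coefficients of `t²`
give `z (z + 1) / 2 + (2 n - z) d ≤ n (n + 1)`. For `d = ⌈n / 2⌉ + 1` the left-hand side is least at
`z = d`, where the inequality fails if and only if `k < 3` for `n = 2 k` and `k² - 5 k - 2 < 0` for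
`n = 2 k + 1`; these are the listed values of `n`.

Lower bound: a partition of the nonempty subsets of `{1, …, n}` into intervals `[A, B]` decomposes
`m` into the spaces `K[xᵢ : i ∈ B] ∏_{i ∈ A} xᵢ`, and for the listed values of `n` there is one with
`|B| ≥ ⌈n / 2⌉` throughout.

Adding the free summand `R` does not change the depth of a decomposition of `m`, so the upper bound
for `R ⊕ m` holds for `m` and the lower bound for `m` holds for `R ⊕ m`.
-/

namespace StanleyDepth

universe u v

section IntervalPartitions

open Finset

/-- The pairs `(a, b)` in `T` are the ends of nonempty intervals `[a, b]` that partition `P`. -/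
structure IsIntervalPartition {α : Type*} [Preorder α] (P : Set α) (T : Set (α × α)) : Prop where
  le : ∀ p ∈ T, p.1 ≤ p.2
  Icc_subset : ∀ p ∈ T, Set.Icc p.1 p.2 ⊆ P
  existsUnique : ∀ s ∈ P, ∃! p, p ∈ T ∧ s ∈ Set.Icc p.1 p.2

namespace IsIntervalPartition

variable {α : Type*} [Preorder α] {P : Set α} {T : Set (α × α)}

theorem pairwise_disjoint (hT : IsIntervalPartition P T) :
    Pairwise (Function.onFun Disjoint fun p : T => Set.Icc p.1.1 p.1.2) := by
  refine fun p q hpq => Set.disjoint_left.2 fun s hp hq => hpq (Subtype.ext ?_)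
  exact (hT.existsUnique s (hT.Icc_subset p p.2 hp)).unique ⟨p.2, hp⟩ ⟨q.2, hq⟩

theorem iUnion_Icc (hT : IsIntervalPartition P T) : ⋃ p : T, Set.Icc p.1.1 p.1.2 = P := by
  refine (Set.iUnion_subset fun p : T => hT.Icc_subset p p.2).antisymm fun s hs => ?_
  obtain ⟨p, hp, -⟩ := hT.existsUnique s hs
  exact Set.mem_iUnion.2 ⟨⟨p, hp.1⟩, hp.2⟩

theorem fst_mem (hT : IsIntervalPartition P T) {p : α × α} (hp : p ∈ T) : p.1 ∈ P :=
  hT.Icc_subset p hp (Set.left_mem_Icc.2 (hT.le p hp))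

end IsIntervalPartition

theorem isIntervalPartition_union_singletons {α : Type*} [PartialOrder α] {P : Set α}
    {T : Set (α × α)} (hle : ∀ p ∈ T, p.1 ≤ p.2) (hP : ∀ p ∈ T, Set.Icc p.1 p.2 ⊆ P)
    (hdisj : T.PairwiseDisjoint fun p => Set.Icc p.1 p.2) :
    IsIntervalPartition P
      (T ∪ (fun s => (s, s)) '' {s ∈ P | ∀ p ∈ T, s ∉ Set.Icc p.1 p.2}) where
  le := by
    rintro p (hp | ⟨s, -, rfl⟩)
    exacts [hle p hp, le_rfl]
  Icc_subset := by
    rintro p (hp | ⟨s, hs, rfl⟩)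
    · exact hP p hp
    · simpa using hs.1
  existsUnique s hs := by
    by_cases h : ∃ p ∈ T, s ∈ Set.Icc p.1 p.2
    · obtain ⟨p, hp, hsp⟩ := h
      refine ⟨p, ⟨.inl hp, hsp⟩, ?_⟩
      rintro q ⟨hq | ⟨t, ht, rfl⟩, hsq⟩
      · exact (hdisj.elim_set hp hq s hsp hsq).symm
      · obtain rfl : t = s := by simpa [eq_comm] using hsq
        exact absurd hsp (ht.2 p hp)
    · push Not at h
      refine ⟨(s, s), ⟨.inr ⟨s, ⟨hs, h⟩, rfl⟩, le_rfl, le_rfl⟩, ?_⟩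
      rintro q ⟨hq | ⟨t, -, rfl⟩, hsq⟩
      · exact absurd hsq (h q hq)
      · obtain rfl : t = s := by simpa [eq_comm] using hsq
        rfl

/-- The subset of `Fin n` encoded by the binary digits of `m`. -/
def bitSet (n m : ℕ) : Finset (Fin n) := {i | m.testBit i}

@[simp]
theorem mem_bitSet {n m : ℕ} {i : Fin n} : i ∈ bitSet n m ↔ m.testBit i = true := by
  simp [bitSet]

theorem bitSet_land (n a b : ℕ) : bitSet n (a &&& b) = bitSet n a ∩ bitSet n b := by
  ext; simp

theorem bitSet_lor (n a b : ℕ) : bitSet n (a ||| b) = bitSet n a ∪ bitSet n b := by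
  ext; simp

theorem exists_bitSet_eq {n : ℕ} (s : Finset (Fin n)) : ∃ m < 2 ^ n, bitSet n m = s :=
  ⟨Nat.ofBits fun i => decide (i ∈ s), Nat.ofBits_lt_two_pow _, by ext; simp⟩

theorem bitSet_injOn (n : ℕ) : Set.InjOn (bitSet n) (Set.Iio (2 ^ n)) := by
  intro a ha b hb hab
  refine Nat.eq_of_testBit_eq fun i => ?_
  rcases lt_or_ge i n with hi | hi
  · exact Bool.eq_iff_iff.2 (by simpa using Finset.ext_iff.1 hab ⟨i, hi⟩)
  · have h2 : 2 ^ n ≤ 2 ^ i := Nat.pow_le_pow_right two_pos hi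
    rw [Nat.testBit_lt_two_pow (ha.trans_le h2), Nat.testBit_lt_two_pow (hb.trans_le h2)]

/-- The cyclic shift by `j` of the subset of `ℤ/n` encoded by the binary digits of `m < 2 ^ n`. -/
def rotate (n j m : ℕ) : ℕ := m * 2 ^ j % 2 ^ n + m * 2 ^ j / 2 ^ n

/-- The first `k` cyclic shifts of `(a, b)`, for each triple `(a, b, k)` in a list. -/
def rotations (n : ℕ) (l : List (ℕ × ℕ × ℕ)) : List (ℕ × ℕ) :=
  l.flatMap fun p => (List.range p.2.2).map fun j => (rotate n j p.1, rotate n j p.2.1)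

/-- Disjoint intervals of subsets of `ℤ/n`, stable under cyclic shifts and given by the binary
encodings of their ends, whose tops have at least `⌈n/2⌉` elements and which cover all smaller
nonempty sets. For `n ≤ 2` there are no smaller nonempty sets. -/
def intervalTable : ℕ → List (ℕ × ℕ)
  | 3 => rotations 3 [(1, 3, 3)]
  | 4 => rotations 4 [(1, 3, 4)]
  | 5 => rotations 5 [(1, 7, 5)]
  | 7 => rotations 7 [(1, 15, 7), (21, 23, 7), (19, 27, 7)]
  | 9 => rotations 9 [(1, 31, 9), (35, 295, 9), (41, 299, 9), (37, 301, 9), (51, 307, 9),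
      (53, 309, 9), (85, 341, 9), (73, 365, 3)]
  | 11 => rotations 11 [(1, 63, 11), (205, 221, 11), (233, 237, 11), (217, 249, 11),
      (299, 303, 11), (301, 317, 11), (331, 335, 11), (333, 349, 11), (137, 669, 11),
      (67, 1103, 11), (81, 1111, 11), (89, 1115, 11), (77, 1117, 11), (99, 1127, 11),
      (105, 1131, 11), (101, 1133, 11), (115, 1139, 11), (117, 1141, 11), (121, 1145, 11),
      (229, 1253, 11), (341, 1365, 11), (73, 1481, 11), (69, 1861, 11)]
  | _ => []

theorem intervalTable_bounds {n : ℕ} (hn : n ∈ ({1, 2, 3, 4, 5, 7, 9, 11} : Finset ℕ)) :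
    ∀ p ∈ intervalTable n, p.1 < 2 ^ n ∧ (bitSet n p.1).Nonempty ∧
      bitSet n p.1 ⊆ bitSet n p.2 ∧ (n + 1) / 2 ≤ #(bitSet n p.2) := by
  revert n
  decide +kernel

theorem intervalTable_pairwise {n : ℕ} (hn : n ∈ ({1, 2, 3, 4, 5, 7, 9, 11} : Finset ℕ)) :
    (intervalTable n).Pairwise fun p q => (p.1 ||| q.1) &&& (p.2 &&& q.2) ≠ p.1 ||| q.1 := by
  revert n
  decide +kernel

theorem intervalTable_cover {n : ℕ} (hn : n ∈ ({1, 2, 3, 4, 5, 7, 9, 11} : Finset ℕ)) :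
    ∀ m < 2 ^ n, m ≠ 0 → #(bitSet n m) < (n + 1) / 2 →
      ∃ p ∈ intervalTable n, (p.1 ||| m) &&& p.2 = m := by
  revert n
  decide +kernel

theorem disjoint_Icc_bitSet {n : ℕ} {p q : ℕ × ℕ} (hp : p.1 < 2 ^ n) (hq : q.1 < 2 ^ n)
    (h : (p.1 ||| q.1) &&& (p.2 &&& q.2) ≠ p.1 ||| q.1) :
    Disjoint (Set.Icc (bitSet n p.1) (bitSet n p.2)) (Set.Icc (bitSet n q.1) (bitSet n q.2)) := by
  rw [Set.disjoint_iff_inter_eq_empty, Set.Icc_inter_Icc, Set.Icc_eq_empty_iff]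
  intro hle
  have hpq := Nat.or_lt_two_pow hp hq
  refine h (bitSet_injOn n ((Nat.and_le_left).trans_lt hpq) hpq ?_)
  rw [bitSet_land, bitSet_land, bitSet_lor]
  exact inter_eq_left.2 hle

theorem intervalTable_pairwiseDisjoint {n : ℕ}
    (hn : n ∈ ({1, 2, 3, 4, 5, 7, 9, 11} : Finset ℕ)) :
    {p | p ∈ intervalTable n}.PairwiseDisjoint
      fun p => Set.Icc (bitSet n p.1) (bitSet n p.2) := by
  have hlt := fun p hp => (intervalTable_bounds hn p hp).1
  have : Std.Symm fun p q : ℕ × ℕ => (p.1 ||| q.1) &&& (p.2 &&& q.2) ≠ p.1 ||| q.1 :=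
    ⟨fun p q h => by rwa [Nat.lor_comm q.1, Nat.land_comm q.2]⟩
  exact fun p hp q hq hpq => disjoint_Icc_bitSet (hlt p hp) (hlt q hq)
    ((intervalTable_pairwise hn).forall hp hq hpq)

theorem exists_isIntervalPartition {n : ℕ} (hn : n ∈ ({1, 2, 3, 4, 5, 7, 9, 11} : Finset ℕ)) :
    ∃ T, IsIntervalPartition {s : Finset (Fin n) | s.Nonempty} T ∧
      ∀ p ∈ T, (n + 1) / 2 ≤ #p.2 := by
  have hb := intervalTable_bounds hn
  let T := (fun p => (bitSet n p.1, bitSet n p.2)) '' {p | p ∈ intervalTable n}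
  refine ⟨_, isIntervalPartition_union_singletons (T := T) ?_ ?_ ?_, ?_⟩
  · rintro _ ⟨p, hp, rfl⟩
    exact (hb p hp).2.2.1
  · rintro _ ⟨p, hp, rfl⟩ s hs
    exact (hb p hp).2.1.mono hs.1
  · rintro _ ⟨p, hp, rfl⟩ _ ⟨q, hq, rfl⟩ hpq
    have hne : p ≠ q := fun h => hpq (by rw [h])
    exact intervalTable_pairwiseDisjoint hn hp hq hne
  · rintro p (⟨p, hp, rfl⟩ | ⟨s, ⟨hs, hsT⟩, rfl⟩)
    · exact (hb p hp).2.2.2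
    · by_contra! hlt
      obtain ⟨m, hm, rfl⟩ := exists_bitSet_eq s
      have hm0 : m ≠ 0 := by
        rintro rfl
        simp [Finset.Nonempty] at hs
      obtain ⟨p, hp, hpm⟩ := intervalTable_cover hn m hm hm0 hlt
      have hclamp : (bitSet n p.1 ∪ bitSet n m) ∩ bitSet n p.2 = bitSet n m := by
        rw [← bitSet_lor, ← bitSet_land, hpm]
      refine hsT _ ⟨p, hp, rfl⟩ ⟨?_, ?_⟩
      · rw [← hclamp]
        exact subset_inter subset_union_left (hb p hp).2.2.1
      · rw [← hclamp]
        exact inter_subset_right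

end IntervalPartitions

section Depth

open CategoryTheory Abelian Limits RingTheory.Sequence
open scoped DirectSum

variable {S : Type u} [CommRing S] (J : Ideal S)

theorem moduleDepth_congr {N N' : Type v} [AddCommGroup N] [Module S N] [AddCommGroup N']
    [Module S N'] (e : N ≃ₗ[S] N') : moduleDepth J N = moduleDepth J N' := by
  simp only [moduleDepth, e.isRegular_congr]

section Noetherian

variable {J} [IsNoetherianRing S]

theorem natCast_le_moduleDepth_iff {N : Type u} [AddCommGroup N] [Module S N] [Module.Finite S N]
    (hN : (J • ⊤ : Submodule S N) < ⊤) {c : ℕ} :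
    (c : ℕ∞) ≤ moduleDepth J N ↔
      ∀ k < c, Subsingleton (Ext (ModuleCat.of S (Shrink.{u} (S ⧸ J))) (ModuleCat.of S N) k) := by
  have rees (d : ℕ) := (ModuleCat.exists_isRegular_tfae J d (ModuleCat.of S N) hN).out 1 3
  constructor
  · intro hc k hk
    obtain ⟨_, ⟨rs, hrs, hreg, rfl⟩, hkd⟩ :=
      lt_sSup_iff.1 ((Nat.cast_lt.2 hk : (k : ℕ∞) < c).trans_le hc)
    exact (rees _).2 ⟨rs, rfl, hrs, hreg⟩ k (Nat.cast_lt.1 hkd)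
  · intro h
    obtain ⟨rs, rfl, hrs, hreg⟩ := (rees c).1 h
    exact le_sSup ⟨rs, hrs, hreg, rfl⟩

theorem moduleDepth_directSum {ι : Type} [Finite ι] [Nonempty ι] {N : ι → Type u}
    [∀ i, AddCommGroup (N i)] [∀ i, Module S (N i)] [∀ i, Module.Finite S (N i)]
    (hN : ∀ i, (J • ⊤ : Submodule S (N i)) < ⊤) :
    moduleDepth J (⨁ i, N i) = ⨅ i, moduleDepth J (N i) := by
  classical
  cases nonempty_fintype ι
  let B : ModuleCat.{u} S := ⨁ fun i => ModuleCat.of S (N i)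
  let e : B ≃ₗ[S] ∀ i, N i := (ModuleCat.biproductIsoPi fun i => ModuleCat.of S (N i)).toLinearEquiv
  have : Module.Finite S B := Module.Finite.equiv e.symm
  have hB : (J • ⊤ : Submodule S B) < ⊤ := by
    let i : ι := Classical.arbitrary ι
    let f : B →ₗ[S] N i := LinearMap.proj i ∘ₗ e.toLinearMap
    have hf : f.range = ⊤ :=
      LinearMap.range_eq_top.2 ((Function.surjective_eval i).comp e.surjective)
    refine lt_top_iff_ne_top.2 fun h => (hN i).ne ?_
    rw [← hf, ← Submodule.map_top, ← Submodule.map_smul'', h]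
  rw [moduleDepth_congr J ((DirectSum.linearEquivFunOnFintype S ι N).trans e.symm)]
  refine ENat.eq_of_forall_natCast_le_iff fun c => ?_
  let E (i : ι) (k : ℕ) := Ext (ModuleCat.of S (Shrink.{u} (S ⧸ J))) (ModuleCat.of S (N i)) k
  have hExt (k : ℕ) : Subsingleton (Ext (ModuleCat.of S (Shrink.{u} (S ⧸ J))) (.of S B) k) ↔
      ∀ i, Subsingleton (E i k) :=
    (Ext.addEquivBiproduct _ (biproduct.isBilimit fun i => ModuleCat.of S (N i)) k).toEquiv
      |>.subsingleton_congr.trans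
        ⟨fun _ i => (Function.surjective_eval (α := ι) (β := (E · k)) i).subsingleton,
          fun _ => Pi.instSubsingleton⟩
  simp only [natCast_le_moduleDepth_iff hB, le_iInf_iff, natCast_le_moduleDepth_iff (hN _), hExt]
  exact ⟨fun h i k hk => h k hk i, fun h k hk i => h i k hk⟩

end Noetherian

theorem supportDim_add_length_le {N : Type v} [AddCommGroup N] [Module S N] [Module.Finite S N]
    (rs : List S) (reg : IsWeaklyRegular N rs) :
    Module.supportDim S (N ⧸ (Ideal.ofList rs • ⊤ : Submodule S N)) + rs.length ≤
      Module.supportDim S N := by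
  induction rs generalizing N with
  | nil =>
    rw [Ideal.ofList_nil, Submodule.bot_smul]
    simpa using (Module.supportDim_eq_of_equiv (Submodule.quotEquivOfEqBot ⊥ rfl)).le
  | cons x rs ih =>
    rw [isWeaklyRegular_cons_iff] at reg
    rw [Module.supportDim_eq_of_equiv
      (Submodule.quotOfListConsSMulTopEquivQuotSMulTopInner N x rs),
      List.length_cons, Nat.cast_add, Nat.cast_one, ← add_assoc]
    have h := Module.supportDim_quotSMulTop_succ_le_of_notMem_minimalPrimes (M := N) (x := x)
      fun _ => reg.1.notMem_of_mem_minimalPrimes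
    exact (add_le_add_left (ih reg.2) 1).trans h

end Depth

section CoordinateProjection

variable {σ : Type*} [DecidableEq σ] {k : Type*} [CommRing k] {Z : Finset σ}

/-- The endomorphism of a polynomial ring that fixes the variables in `Z` and kills the others. -/
noncomputable def coordProj (k : Type*) [CommRing k] (Z : Finset σ) :
    MvPolynomial σ k →ₐ[k] MvPolynomial σ k :=
  aeval fun i => if i ∈ Z then X i else 0

/-- The kernel of `coordProj k Z`, presented as the ideal generated by the variables outside `Z`. -/
noncomputable def coordIdeal {σ : Type*} (k : Type*) [CommRing k] (Z : Finset σ) :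
    Ideal (MvPolynomial σ k) :=
  Ideal.span (X '' {i | i ∉ Z})

theorem coordProj_monomial (Z : Finset σ) (d : σ →₀ ℕ) (c : k) :
    coordProj k Z (monomial d c) = if d.support ⊆ Z then monomial d c else 0 := by
  rw [coordProj, aeval_monomial]
  split_ifs with h
  · rw [monomial_eq, algebraMap_eq]
    exact congrArg _ (Finset.prod_congr rfl fun i hi => by simp only [if_pos (h hi)])
  · obtain ⟨i, hi, hiZ⟩ := Finset.not_subset.1 h
    rw [Finsupp.prod, Finset.prod_eq_zero hi, mul_zero]
    rw [if_neg hiZ, zero_pow (Finsupp.mem_support_iff.1 hi)]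

theorem coeff_coordProj (Z : Finset σ) (d : σ →₀ ℕ) (f : MvPolynomial σ k) :
    coeff d (coordProj k Z f) = if d.support ⊆ Z then coeff d f else 0 := by
  induction f using MvPolynomial.induction_on' with
  | monomial e c =>
    rw [coordProj_monomial, apply_ite (coeff d), coeff_monomial, coeff_zero]
    by_cases h : e = d
    · subst h; rfl
    · simp [h]
  | add p q hp hq =>
    rw [map_add, coeff_add, hp, hq, coeff_add]
    split_ifs <;> simp

theorem coordProj_coordProj (Z : Finset σ) (f : MvPolynomial σ k) :
    coordProj k Z (coordProj k Z f) = coordProj k Z f := by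
  ext d
  simp only [coeff_coordProj, ← ite_and, and_self]

theorem coordProj_eq_self_iff {f : MvPolynomial σ k} :
    coordProj k Z f = f ↔ f ∈ restrictSupport k {d | d.support ⊆ Z} := by
  simp only [MvPolynomial.ext_iff, coeff_coordProj, ite_eq_left_iff, mem_restrictSupport_iff,
    Set.subset_def, Finset.mem_coe, mem_support_iff]
  exact forall_congr' fun d => ⟨fun h hd => by_contra fun hs => hd (h hs).symm,
    fun h hs => (not_imp_comm.1 h hs).symm⟩

theorem coordProj_eq_zero_iff {f : MvPolynomial σ k} :
    coordProj k Z f = 0 ↔ f ∈ coordIdeal k Z := by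
  simp only [MvPolynomial.ext_iff, coeff_coordProj, coeff_zero, ite_eq_right_iff, coordIdeal,
    mem_ideal_span_X_image, mem_support_iff]
  refine forall_congr' fun d => not_imp_not.symm.trans (imp_congr_right fun _ => ?_)
  simp only [Finset.not_subset, Finsupp.mem_support_iff, Set.mem_ofPred_eq, and_comm]

end CoordinateProjection

section Retract

variable {K : Type u} [Field K] {n : ℕ}

theorem weight_single_eq (d : Fin n →₀ ℕ) :
    Finsupp.weight (fun i : Fin n => (Pi.single i 1 : Fin n → ℤ)) d = fun i => (d i : ℤ) := by
  funext j
  rw [Finsupp.weight_apply, Finsupp.sum_fintype _ _ (by simp)]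
  simp [Finset.sum_apply, Pi.single_apply]

theorem mem_multigrading {a : Fin n → ℤ} {f : MvPolynomial (Fin n) K} :
    f ∈ multigrading K n a ↔ ∀ d, coeff d f ≠ 0 → (fun i => (d i : ℤ)) = a := by
  rw [multigrading, mem_weightedHomogeneousSubmodule, IsWeightedHomogeneous]
  simp only [weight_single_eq]

theorem monomial_mem_multigrading (d : Fin n →₀ ℕ) (c : K) :
    monomial d c ∈ multigrading K n fun i => (d i : ℤ) := by
  rw [mem_multigrading]
  intro e he
  rw [coeff_monomial] at he
  rw [(ite_ne_right_iff.1 he).1]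

theorem multigrading_natCast (d : Fin n →₀ ℕ) :
    multigrading K n (fun i => (d i : ℤ)) = K ∙ monomial d 1 := by
  refine le_antisymm (fun f hf => Submodule.mem_span_singleton.2 ⟨coeff d f, ?_⟩)
    ((Submodule.span_singleton_le_iff_mem _ _).2 (monomial_mem_multigrading d 1))
  ext e
  rw [smul_monomial, smul_eq_mul, mul_one, coeff_monomial]
  split_ifs with h
  · rw [h]
  · by_contra he
    have := mem_multigrading.1 hf e (Ne.symm he)
    exact h (Finsupp.ext fun i => (Nat.cast_injective (congrFun this i)).symm)

namespace GradedRetract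

/-- The retract `K[xᵢ : i ∈ Z]`. -/
noncomputable def ofVars (K : Type u) [Field K] (Z : Finset (Fin n)) : GradedRetract K n where
  proj := coordProj K Z
  proj_proj := coordProj_coordProj Z
  proj_mem a f hf := by
    rw [mem_multigrading] at hf ⊢
    intro d hd
    rw [coeff_coordProj] at hd
    exact hf d (ite_ne_right_iff.1 hd).2

open Classical in
/-- The set of variables contained in a graded retract. -/
noncomputable def vars (A : GradedRetract K n) : Finset (Fin n) :=
  Finset.univ.filter fun i => A.proj (X i) = X i

theorem mem_vars {A : GradedRetract K n} {i : Fin n} : i ∈ A.vars ↔ A.proj (X i) = X i := by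
  simp only [vars, Finset.mem_filter, Finset.mem_univ, true_and]

theorem vars_ofVars (Z : Finset (Fin n)) : (ofVars K Z).vars = Z := by
  ext i
  rw [mem_vars]
  change coordProj K Z (X i) = X i ↔ _
  rw [coordProj, aeval_X]
  simp [(X_ne_zero i).symm]

theorem proj_eq_coordProj (A : GradedRetract K n) : A.proj = coordProj K A.vars := by
  refine MvPolynomial.algHom_ext fun i => ?_
  obtain ⟨c, hc⟩ : ∃ c : K, c • X i = A.proj (X i) := by
    have h := A.proj_mem _ _ (monomial_mem_multigrading (Finsupp.single i 1) 1)
    rwa [multigrading_natCast, Submodule.mem_span_singleton] at h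
  have hcc : (c * c) • (X i : MvPolynomial (Fin n) K) = c • X i := by
    rw [mul_smul, hc, ← map_smul, hc, A.proj_proj]
  have hidem : c = 0 ∨ c = 1 :=
    IsIdempotentElem.iff_eq_zero_or_one.1 (smul_left_injective K (X_ne_zero i) hcc)
  rw [coordProj, aeval_X]
  split_ifs with h
  · exact mem_vars.1 h
  · rw [mem_vars, ← hc] at h
    rcases hidem with rfl | rfl
    · rw [← hc, zero_smul]
    · exact absurd (one_smul K _) h

theorem toSubmodule_subalgebra (A : GradedRetract K n) :
    Subalgebra.toSubmodule A.subalgebra = restrictSupport K {d | d.support ⊆ A.vars} := by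
  ext f
  rw [← coordProj_eq_self_iff, ← proj_eq_coordProj]
  exact ⟨fun ⟨g, hg⟩ => hg ▸ A.proj_proj g, fun h => ⟨f, h⟩⟩

theorem monomial_mem_subalgebra {A : GradedRetract K n} {d : Fin n →₀ ℕ} (hd : d.support ⊆ A.vars)
    (c : K) : monomial d c ∈ A.subalgebra := by
  rw [← Subalgebra.mem_toSubmodule, toSubmodule_subalgebra]
  exact (monomial_mem_restrictSupport K).2 (.inl hd)

/-- The retraction `R → A` as a map of `R`-modules. -/
noncomputable def toAsModule (A : GradedRetract K n) :
    MvPolynomial (Fin n) K →ₗ[MvPolynomial (Fin n) K] A.AsModule where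
  toFun f := A.proj.rangeRestrict f
  map_add' := map_add _
  map_smul' := map_mul A.proj.rangeRestrict

theorem ker_toAsModule (A : GradedRetract K n) : A.toAsModule.ker = coordIdeal K A.vars := by
  ext f
  rw [← coordProj_eq_zero_iff, ← proj_eq_coordProj, LinearMap.mem_ker]
  exact Subtype.ext_iff (a1 := A.proj.rangeRestrict f) (a2 := 0)

/-- A graded retract, as an `R`-module, is `R` modulo the variables that it does not contain. -/
noncomputable def quotientEquivAsModule (A : GradedRetract K n) :
    (MvPolynomial (Fin n) K ⧸ coordIdeal K A.vars) ≃ₗ[MvPolynomial (Fin n) K] A.AsModule :=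
  (Submodule.quotEquivOfEq _ _ A.ker_toAsModule.symm).trans
    (A.toAsModule.quotKerEquivOfSurjective A.proj.rangeRestrict_surjective)

end GradedRetract

end Retract

section RegularVariables

open RingTheory.Sequence

theorem ofList_map_X {σ k : Type*} [CommRing k] (l : List σ) :
    Ideal.ofList (l.map (X : σ → MvPolynomial σ k)) = Ideal.span (X '' {i | i ∈ l}) := by
  rw [Ideal.ofList]
  congr 1
  ext
  simp

theorem isWeaklyRegular_map_X {σ k : Type*} [CommRing k] {l : List σ} (hl : l.Nodup) :
    IsWeaklyRegular (MvPolynomial σ k) (l.map (X : σ → MvPolynomial σ k)) := by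
  induction l using List.reverseRecOn with
  | nil => exact .nil _ _
  | append_singleton l i ih =>
    rw [List.nodup_append] at hl
    have hne {j : σ} (hj : j ∈ l) : j ≠ i := hl.2.2 j hj i (List.mem_singleton_self i)
    rw [List.map_append, isWeaklyRegular_append_iff, List.map_singleton,
      isWeaklyRegular_singleton_iff, isSMulRegular_quotient_iff_mem_of_smul_mem]
    refine ⟨ih hl.1, fun f hf => ?_⟩
    rw [smul_eq_mul, Ideal.mul_top, ofList_map_X, mem_ideal_span_X_image] at hf ⊢
    intro d hd
    obtain ⟨j, hj, hdj⟩ := hf (Finsupp.single i 1 + d) (by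
      rwa [mem_support_iff, smul_eq_mul, coeff_X_mul, ← mem_support_iff])
    refine ⟨j, hj, ?_⟩
    rwa [Finsupp.add_apply, Finsupp.single_eq_of_ne (hne hj), zero_add] at hdj

theorem isWeaklyRegular_map_X_append_iff {σ k : Type*} [CommRing k] {Z : Finset σ} {l : List σ}
    (hl : l.Nodup) (hlZ : ∀ i, i ∈ l ↔ i ∉ Z) (rs : List (MvPolynomial σ k)) :
    IsWeaklyRegular (MvPolynomial σ k) (l.map X ++ rs) ↔
      IsWeaklyRegular (MvPolynomial σ k ⧸ coordIdeal k Z) rs := by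
  have heq : (Ideal.ofList (l.map (X : σ → MvPolynomial σ k)) • ⊤ : Ideal (MvPolynomial σ k)) =
      coordIdeal k Z := by
    simp only [smul_eq_mul, Ideal.mul_top, ofList_map_X, hlZ, coordIdeal]
  rw [isWeaklyRegular_append_iff, and_iff_right (isWeaklyRegular_map_X hl),
    (Submodule.quotEquivOfEq _ _ heq).isWeaklyRegular_congr]

theorem smul_top_quotient_lt_top {S : Type*} [CommRing S] {I J : Ideal S} (hIJ : I ≤ J)
    (hJ : J ≠ ⊤) : (J • ⊤ : Submodule S (S ⧸ I)) < ⊤ := by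
  refine lt_top_iff_ne_top.2 fun h => hJ ?_
  have hmap : Submodule.map I.mkQ J = ⊤ := by
    rw [← h, ← Submodule.range_mkQ, ← Submodule.map_top, ← Submodule.map_smul'', smul_eq_mul,
      Ideal.mul_top]
  have hcomap := congrArg (Submodule.comap I.mkQ) hmap
  rwa [Submodule.comap_map_mkQ, Submodule.comap_top, sup_eq_right.2 hIJ] at hcomap

theorem coordIdeal_le_idealOfVars {σ k : Type*} [CommRing k] (Z : Finset σ) :
    coordIdeal k Z ≤ idealOfVars σ k :=
  Ideal.span_mono (Set.image_subset_range _ _)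

theorem idealOfVars_ne_top (σ k : Type*) [CommRing k] [Nontrivial k] : idealOfVars σ k ≠ ⊤ := by
  have hone := (C_mem_pow_idealOfVars_iff (σ := σ) (R := k) 1 1).not.2 (by simp)
  rw [pow_one, C_1] at hone
  exact (Ideal.ne_top_iff_one _).2 hone

theorem length_le_card_of_isWeaklyRegular {σ k : Type*} [Fintype σ] [Field k]
    {rs : List (MvPolynomial σ k)} (hrs : ∀ r ∈ rs, r ∈ idealOfVars σ k)
    (reg : IsWeaklyRegular (MvPolynomial σ k) rs) :
    rs.length ≤ Fintype.card σ := by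
  have hdim := supportDim_add_length_le rs reg
  rw [Module.supportDim_self_eq_ringKrullDim, ringKrullDim_of_isNoetherianRing,
    ringKrullDim_eq_zero_of_field, zero_add, Nat.card_eq_fintype_card] at hdim
  have : Nontrivial (MvPolynomial σ k ⧸ (Ideal.ofList rs • ⊤ : Ideal (MvPolynomial σ k))) := by
    rw [smul_eq_mul, Ideal.mul_top]
    exact Ideal.Quotient.nontrivial_iff.2
      (ne_top_of_le_ne_top (idealOfVars_ne_top σ k) (Ideal.span_le.2 hrs))
  obtain ⟨c, hc⟩ := WithBot.ne_bot_iff_exists.1 (Module.supportDim_ne_bot_of_nontrivial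
    (MvPolynomial σ k) (MvPolynomial σ k ⧸ (Ideal.ofList rs • ⊤ : Ideal (MvPolynomial σ k))))
  rw [← hc] at hdim
  have : (rs.length : ℕ∞) ≤ Fintype.card σ :=
    le_add_self.trans (WithBot.coe_le_coe.1 hdim)
  exact_mod_cast this

theorem moduleDepth_quotient_coordIdeal {σ k : Type*} [Finite σ] [Field k] (Z : Finset σ) :
    moduleDepth (idealOfVars σ k) (MvPolynomial σ k ⧸ coordIdeal k Z) = Z.card := by
  classical
  cases nonempty_fintype σ
  have hl : (Zᶜ).toList.Nodup := Finset.nodup_toList _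
  have happend := isWeaklyRegular_map_X_append_iff (k := k) (Z := Z) hl fun i => by simp
  have hvar (l : List σ) : ∀ r ∈ l.map (X : σ → MvPolynomial σ k), r ∈ idealOfVars σ k :=
    List.forall_mem_map.2 fun i _ => Ideal.subset_span (Set.mem_range_self i)
  apply le_antisymm
  · refine sSup_le ?_
    rintro _ ⟨rs, hrs, hreg, rfl⟩
    have := length_le_card_of_isWeaklyRegular
      (List.forall_mem_append.2 ⟨hvar _, hrs⟩) ((happend rs).2 hreg.toIsWeaklyRegular)
    rw [List.length_append, List.length_map, Finset.length_toList, ← Z.card_compl_add_card] at this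
    exact_mod_cast Nat.le_of_add_le_add_left this
  · refine le_sSup ⟨Z.toList.map X, hvar _, ⟨(happend _).1 ?_, ?_⟩, by simp⟩
    · rw [← List.map_append]
      exact isWeaklyRegular_map_X (hl.append Z.nodup_toList fun i => by simp)
    · refine (lt_of_le_of_lt (Submodule.smul_mono_left (Ideal.span_le.2 (hvar _))) ?_).ne'
      exact smul_top_quotient_lt_top (coordIdeal_le_idealOfVars Z) (idealOfVars_ne_top σ k)

end RegularVariables

namespace StanleyDecomposition

open scoped DirectSum

variable {K : Type u} [Field K] {n : ℕ} {M : Type v} [AddCommGroup M]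
  [Module (MvPolynomial (Fin n) K) M] [Module K M] [IsScalarTower K (MvPolynomial (Fin n) K) M]
  {𝓜 : (Fin n → ℤ) → Submodule K M}

theorem size_pos [Nontrivial M] (D : StanleyDecomposition 𝓜) : 0 < D.size := by
  refine Nat.pos_of_ne_zero fun h => bot_ne_top (α := Submodule K M) ?_
  have : IsEmpty (Fin D.size) := by rw [h]; infer_instance
  rw [← D.isInternal.submodule_iSup_eq_top, iSup_of_empty]

theorem depth_eq_iInf_card_vars [Nontrivial M] (D : StanleyDecomposition 𝓜) :
    D.depth = ⨅ i, ((D.retract i).vars.card : ℕ∞) := by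
  have : Nonempty (Fin D.size) := ⟨0, D.size_pos⟩
  calc
    D.depth = moduleDepth (idealOfVars (Fin n) K)
        (⨁ i, MvPolynomial (Fin n) K ⧸ coordIdeal K (D.retract i).vars) :=
      moduleDepth_congr _
        (DirectSum.congrLinearEquiv fun i => (D.retract i).quotientEquivAsModule.symm)
    _ = ⨅ i, moduleDepth (idealOfVars (Fin n) K)
        (MvPolynomial (Fin n) K ⧸ coordIdeal K (D.retract i).vars) :=
      moduleDepth_directSum fun i =>
        smul_top_quotient_lt_top (coordIdeal_le_idealOfVars _) (idealOfVars_ne_top _ K)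
    _ = ⨅ i, ((D.retract i).vars.card : ℕ∞) := by simp only [moduleDepth_quotient_coordIdeal]

end StanleyDecomposition

section HilbertFunction

open Module

variable {K : Type u} [Field K] {n : ℕ} {M : Type v} [AddCommGroup M]
  [Module (MvPolynomial (Fin n) K) M] [Module K M] [IsScalarTower K (MvPolynomial (Fin n) K) M]
  {𝓜 : (Fin n → ℤ) → Submodule K M}

/-- The family `𝓜` is a `ℤⁿ`-grading of the `R`-module `M`. That the components span `M` is left
out, since it follows from the existence of a Stanley decomposition. -/
structure IsMultigrading (𝓜 : (Fin n → ℤ) → Submodule K M) : Prop where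
  iSupIndep : iSupIndep 𝓜
  monomial_smul_mem : ∀ (d : Fin n →₀ ℕ) {a : Fin n → ℤ} {u : M}, u ∈ 𝓜 a →
    (monomial d 1 : MvPolynomial (Fin n) K) • u ∈ 𝓜 (a + fun i => (d i : ℤ))

theorem retractSpan_eq_span (A : GradedRetract K n) (u : M) :
    retractSpan A u = Submodule.span K
      ((fun d => (monomial d 1 : MvPolynomial (Fin n) K) • u) '' {d | d.support ⊆ A.vars}) := by
  rw [retractSpan, A.toSubmodule_subalgebra, restrictSupport_eq_span, Submodule.map_span,
    Set.image_image]
  rfl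

namespace StanleyDecomposition

variable {D : StanleyDecomposition 𝓜}

theorem gen_ne_zero (D : StanleyDecomposition 𝓜) (i : Fin D.size) : D.gen i ≠ 0 := fun h =>
  one_ne_zero (D.ann_eq_zero i 1 (one_mem _) (by rw [h, smul_zero]))

/-- The elements `xᵈ uᵢ` with `xᵈ ∈ Rᵢ` that have degree `a` when each `uᵢ` has degree `e i`. -/
def basisElements (D : StanleyDecomposition 𝓜) (e : Fin D.size → Fin n → ℤ) (a : Fin n → ℤ) :
    Set M :=
  {x | ∃ i, ∃ d : Fin n →₀ ℕ, d.support ⊆ (D.retract i).vars ∧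
    (e i + fun j => (d j : ℤ)) = a ∧ (monomial d 1 : MvPolynomial (Fin n) K) • D.gen i = x}

theorem component_eq_span {e : Fin D.size → Fin n → ℤ} (h𝓜 : IsMultigrading 𝓜)
    (he : ∀ i, D.gen i ∈ 𝓜 (e i)) (a : Fin n → ℤ) :
    𝓜 a = Submodule.span K (D.basisElements e a) := by
  let W (a : Fin n → ℤ) : Submodule K M := Submodule.span K (D.basisElements e a)
  have hle : W ≤ 𝓜 := fun a => Submodule.span_le.2 fun x ⟨i, d, _, hda, hx⟩ =>
    hx ▸ hda ▸ h𝓜.monomial_smul_mem d (he i)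
  have htop : ⨆ a, W a = ⊤ := by
    rw [eq_top_iff, ← D.isInternal.submodule_iSup_eq_top]
    refine iSup_le fun i => ?_
    rw [retractSpan_eq_span, Submodule.span_le]
    rintro _ ⟨d, hd, rfl⟩
    exact Submodule.mem_iSup_of_mem _ (Submodule.subset_span ⟨i, d, hd, rfl, rfl⟩)
  exact (congrFun ((h𝓜.iSupIndep.le_iff_eq_of_iSup_eq_top htop).1 hle) a).symm

theorem finrank_eq_card {e : Fin D.size → Fin n →₀ ℕ} (h𝓜 : IsMultigrading 𝓜)
    (he : ∀ i, D.gen i ∈ 𝓜 fun j => (e i j : ℤ)) (a : Fin n →₀ ℕ) :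
    finrank K (𝓜 fun j => (a j : ℤ)) =
      Finset.card {i | e i ≤ a ∧ (a - e i).support ⊆ (D.retract i).vars} := by
  let w (i : {i // e i ≤ a ∧ (a - e i).support ⊆ (D.retract i).vars}) : M :=
    (monomial (a - e i) 1 : MvPolynomial (Fin n) K) • D.gen i
  have hw : LinearIndependent K w := by
    refine (D.isInternal.submodule_iSupIndep.comp Subtype.val_injective).linearIndependent _
      (fun i => ?_) fun i hi => ?_
    · rw [Function.comp_apply, retractSpan_eq_span]
      exact Submodule.subset_span ⟨_, i.2.2, rfl⟩
    · exact one_ne_zero (monomial_eq_zero.1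
        (D.ann_eq_zero i _ (GradedRetract.monomial_mem_subalgebra i.2.2 1) hi))
  have hspan : 𝓜 (fun j => (a j : ℤ)) = Submodule.span K (Set.range w) := by
    rw [component_eq_span h𝓜 he]
    congr 1
    ext x
    constructor
    · rintro ⟨i, d, hd, hda, rfl⟩
      obtain rfl : e i + d = a := Finsupp.ext fun j =>
        Nat.cast_injective ((Nat.cast_add _ _).trans (congrFun hda j))
      exact ⟨⟨i, le_self_add, by rwa [add_tsub_cancel_left]⟩,
        by simp only [w, add_tsub_cancel_left]⟩
    · rintro ⟨⟨i, hi⟩, rfl⟩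
      refine ⟨i, a - e i, hi.2, funext fun j => ?_, rfl⟩
      exact (Nat.cast_add _ _).symm.trans
        (congrArg Nat.cast (DFunLike.congr_fun (add_tsub_cancel_of_le hi.1) j))
  rw [hspan, finrank_span_eq_card hw, Fintype.card_subtype]

end StanleyDecomposition

end HilbertFunction

section DirectSumGrading

open Module

theorem iSupIndep_prod {R M N ι : Type*} [Ring R] [AddCommGroup M] [Module R M] [AddCommGroup N]
    [Module R N] {p : ι → Submodule R M} {q : ι → Submodule R N} (hp : iSupIndep p)
    (hq : iSupIndep q) : iSupIndep fun i => (p i).prod (q i) := by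
  intro i
  refine Disjoint.mono_right (iSup₂_le fun j hj => Submodule.prod_mono
    (le_iSup₂_of_le j hj le_rfl) (le_iSup₂_of_le j hj le_rfl)) (disjoint_iff.2 ?_)
  rw [Submodule.prod_inf_prod, (hp i).eq_bot, (hq i).eq_bot, Submodule.prod_bot]

theorem iSupIndep_comap {R M N ι : Type*} [Ring R] [AddCommGroup M] [Module R M] [AddCommGroup N]
    [Module R N] {f : M →ₗ[R] N} (hf : Function.Injective f) {p : ι → Submodule R N}
    (hp : iSupIndep p) : iSupIndep fun i => (p i).comap f := by
  intro i
  refine Disjoint.mono_right (iSup₂_le fun j hj =>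
    Submodule.comap_mono (le_iSup₂_of_le j hj le_rfl)) (disjoint_iff.2 ?_)
  rw [← Submodule.comap_inf, (hp i).eq_bot, Submodule.comap_bot, LinearMap.ker_eq_bot.2 hf]

theorem finrank_submodule_prod {k V W : Type*} [Field k] [AddCommGroup V] [Module k V]
    [AddCommGroup W] [Module k W] (p : Submodule k V) (q : Submodule k W) [FiniteDimensional k p]
    [FiniteDimensional k q] : finrank k (p.prod q) = finrank k p + finrank k q := by
  let e : p.prod q ≃ₗ[k] p × q :=
    { p.toAddSubmonoid.prodEquiv q.toAddSubmonoid with map_smul' := fun _ _ => rfl }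
  rw [e.finrank_eq, finrank_prod]

variable {K : Type u} [Field K] {n : ℕ}

theorem iSupIndep_multigrading : iSupIndep (multigrading K n) :=
  let _ := weightedGradedAlgebra K fun i : Fin n => (Pi.single i 1 : Fin n → ℤ)
  (DirectSum.Decomposition.isInternal
    (weightedHomogeneousSubmodule K fun i : Fin n => (Pi.single i 1 : Fin n → ℤ)))
    |>.submodule_iSupIndep

theorem monomial_mul_mem_multigrading (d : Fin n →₀ ℕ) {a : Fin n → ℤ}
    {f : MvPolynomial (Fin n) K} (hf : f ∈ multigrading K n a) :
    monomial d 1 * f ∈ multigrading K n (a + fun i => (d i : ℤ)) := by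
  rw [add_comm]
  exact IsWeightedHomogeneous.mul (monomial_mem_multigrading d 1) hf

theorem isMultigrading_directSumGrading : IsMultigrading (directSumGrading K n) where
  iSupIndep := iSupIndep_prod iSupIndep_multigrading
    (iSupIndep_comap Subtype.val_injective iSupIndep_multigrading)
  monomial_smul_mem d _ _ h :=
    ⟨monomial_mul_mem_multigrading d h.1, monomial_mul_mem_multigrading d h.2⟩

theorem exists_natCast_eq_of_mem_multigrading {a : Fin n → ℤ} {f : MvPolynomial (Fin n) K}
    (hf : f ∈ multigrading K n a) (hf0 : f ≠ 0) : ∃ d : Fin n →₀ ℕ, (fun i => (d i : ℤ)) = a := by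
  obtain ⟨d, hd⟩ := ne_zero_iff.1 hf0
  exact ⟨d, mem_multigrading.1 hf d hd⟩

theorem exists_natCast_eq_of_mem_directSumGrading {a : Fin n → ℤ}
    {x : MvPolynomial (Fin n) K × idealOfVars (Fin n) K} (hx : x ∈ directSumGrading K n a)
    (hx0 : x ≠ 0) : ∃ d : Fin n →₀ ℕ, (fun i => (d i : ℤ)) = a := by
  by_cases h : x.1 = 0
  · exact exists_natCast_eq_of_mem_multigrading hx.2 fun h2 => hx0 (Prod.ext h (Subtype.ext h2))
  · exact exists_natCast_eq_of_mem_multigrading hx.1 h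

theorem monomial_mem_idealOfVars_iff {σ k : Type*} [CommRing k] [Nontrivial k] {d : σ →₀ ℕ} :
    monomial d (1 : k) ∈ idealOfVars σ k ↔ d ≠ 0 := by
  rw [← pow_one (idealOfVars σ k), monomial_mem_pow_idealOfVars_iff 1 d one_ne_zero,
    Nat.one_le_iff_ne_zero, ne_eq, Finsupp.degree_eq_zero_iff]

theorem maxIdealGrading_zero : maxIdealGrading K n 0 = ⊥ := by
  refine (Submodule.eq_bot_iff _).2 fun ⟨f, hf⟩ hf0 => Subtype.ext ?_
  obtain ⟨c, rfl⟩ : ∃ c : K, c • monomial 0 1 = f := by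
    rw [← Submodule.mem_span_singleton, ← multigrading_natCast]
    exact hf0
  rw [smul_monomial, smul_eq_mul, mul_one, ← C_apply, ← pow_one (idealOfVars _ K),
    C_mem_pow_idealOfVars_iff, or_iff_left one_ne_zero] at hf
  subst hf
  exact zero_smul K _

theorem maxIdealGrading_natCast {d : Fin n →₀ ℕ} (hd : d ≠ 0) :
    maxIdealGrading K n (fun i => (d i : ℤ)) =
      K ∙ (⟨monomial d 1, monomial_mem_idealOfVars_iff.2 hd⟩ : idealOfVars (Fin n) K) := by
  ext f
  simp only [Submodule.mem_span_singleton, Subtype.ext_iff]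
  rw [maxIdealGrading, multigrading_natCast]
  exact Submodule.mem_span_singleton

theorem finrank_directSumGrading_zero : finrank K (directSumGrading K n 0) = 1 := by
  have h0 : multigrading K n 0 = K ∙ monomial 0 1 := multigrading_natCast 0
  rw [directSumGrading, maxIdealGrading_zero, h0, finrank_submodule_prod, finrank_bot,
    finrank_span_singleton (monomial_eq_zero.not.2 one_ne_zero)]

theorem finrank_directSumGrading_natCast {d : Fin n →₀ ℕ} (hd : d ≠ 0) :
    finrank K (directSumGrading K n fun i => (d i : ℤ)) = 2 := by
  have h0 : (monomial d 1 : MvPolynomial (Fin n) K) ≠ 0 := monomial_eq_zero.not.2 one_ne_zero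
  rw [directSumGrading, maxIdealGrading_natCast hd, multigrading_natCast, finrank_submodule_prod,
    finrank_span_singleton h0, finrank_span_singleton fun h => h0 (congrArg Subtype.val h)]

end DirectSumGrading

section HilbertSeries

open Module

theorem mem_finsuppAntidiag_iff_degree {ι : Type*} [DecidableEq ι] {S : Finset ι} {m : ℕ}
    {a : ι →₀ ℕ} : a ∈ S.finsuppAntidiag m ↔ a.degree = m ∧ a.support ⊆ S :=
  Finset.mem_finsuppAntidiag'

theorem card_filter_finsuppAntidiag {ι : Type*} [Fintype ι] [DecidableEq ι] (e : ι →₀ ℕ)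
    (Z : Finset ι) (m : ℕ) :
    Finset.card {a ∈ Finset.univ.finsuppAntidiag m | e ≤ a ∧ (a - e).support ⊆ Z} =
      if e.degree ≤ m then Z.card.multichoose (m - e.degree) else 0 := by
  split_ifs with hm
  · rw [← Finset.card_finsuppAntidiag_nat_eq_multichoose]
    refine Finset.card_nbij' (· - e) (· + e) (fun a ha => ?_) (fun b hb => ?_) (fun a ha => ?_)
      fun b _ => add_tsub_cancel_right b e
    · simp only [Finset.coe_filter, Set.mem_ofPred_eq, mem_finsuppAntidiag_iff_degree] at ha
      rw [Finset.mem_coe, mem_finsuppAntidiag_iff_degree]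
      refine ⟨eq_tsub_of_add_eq ?_, ha.2.2⟩
      rw [← map_add, tsub_add_cancel_of_le ha.2.1, ha.1.1]
    · rw [Finset.mem_coe, mem_finsuppAntidiag_iff_degree] at hb
      simp only [Finset.coe_filter, Set.mem_ofPred_eq, mem_finsuppAntidiag_iff_degree, map_add,
        hb.1, add_tsub_cancel_right, tsub_add_cancel_of_le hm, le_add_self, Finset.subset_univ,
        hb.2, and_self]
    · exact tsub_add_cancel_of_le (Finset.mem_filter.1 ha).2.1
  · refine Finset.card_eq_zero.2 (Finset.filter_eq_empty_iff.2 fun a ha h => hm ?_)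
    rw [← (mem_finsuppAntidiag_iff_degree.1 ha).1]
    exact Finsupp.degree_mono h.1

/-- The coefficient of `tᵐ` in `∑ᵢ t ^ δ i / (1 - t) ^ z i`. -/
def hilbertCoeff {ι : Type*} [Fintype ι] (z δ : ι → ℕ) (m : ℕ) : ℕ :=
  ∑ i with δ i ≤ m, (z i).multichoose (m - δ i)

theorem exists_multichoose_two_add_le_hilbertCoeff {ι : Type*} [Fintype ι] {z δ : ι → ℕ} {d : ℕ}
    (h₀ : hilbertCoeff z δ 0 = 1) (hd : ∀ i, d ≤ z i) :
    ∃ i, (z i).multichoose 2 + d * hilbertCoeff z δ 1 ≤ hilbertCoeff z δ 2 + d * z i := by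
  classical
  let F : Finset ι := {i | δ i = 1}
  obtain ⟨i, hi⟩ : ∃ i, Finset.filter (δ · ≤ 0) Finset.univ = {i} := by
    rw [← Finset.card_eq_one, ← h₀, Finset.card_eq_sum_ones, hilbertCoeff]
    simp only [Nat.zero_sub, Nat.multichoose_zero_right]
  have hδ (j : ι) : δ j ≤ 0 ↔ j = i := by
    simpa using congrArg (j ∈ ·) hi
  have hδi : δ i = 0 := Nat.le_zero.1 ((hδ i).2 rfl)
  have hiF : i ∉ F := by simp [F, hδi]
  have hF : Finset.filter (δ · ≤ 1) Finset.univ = insert i F := by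
    ext j
    simp only [Finset.mem_filter_univ, Finset.mem_insert, F, ← hδ]
    omega
  have hsum (m : ℕ) : ∑ j with δ j ≤ 1, (z j).multichoose (m + 1 - δ j) =
      (z i).multichoose (m + 1) + ∑ j ∈ F, (z j).multichoose m := by
    rw [hF, Finset.sum_insert hiF, hδi, Nat.sub_zero]
    refine congrArg _ (Finset.sum_congr rfl fun j hj => ?_)
    rw [(Finset.mem_filter.1 hj).2, Nat.add_sub_cancel]
  have h₁ : hilbertCoeff z δ 1 = z i + F.card := by
    simpa [hilbertCoeff] using hsum 0
  have h₂ : (z i).multichoose 2 + ∑ j ∈ F, z j ≤ hilbertCoeff z δ 2 := by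
    have := hsum 1
    simp only [Nat.multichoose_one_right, Nat.reduceAdd] at this
    rw [← this]
    exact Finset.sum_le_sum_of_subset
      (Finset.monotone_filter_right _ fun j _ hj => le_trans hj one_le_two)
  have h₃ : d * F.card ≤ ∑ j ∈ F, z j := by
    rw [mul_comm, ← smul_eq_mul]
    exact F.card_nsmul_le_sum _ _ fun j _ => hd j
  refine ⟨i, ?_⟩
  rw [h₁, mul_add]
  omega

namespace StanleyDecomposition

variable {K : Type u} [Field K] {n : ℕ}

theorem sum_finrank_eq_hilbertCoeff {M : Type v} [AddCommGroup M]
    [Module (MvPolynomial (Fin n) K) M] [Module K M] [IsScalarTower K (MvPolynomial (Fin n) K) M]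
    {𝓜 : (Fin n → ℤ) → Submodule K M} {D : StanleyDecomposition 𝓜}
    {e : Fin D.size → Fin n →₀ ℕ} (h𝓜 : IsMultigrading 𝓜)
    (he : ∀ i, D.gen i ∈ 𝓜 fun j => (e i j : ℤ)) (m : ℕ) :
    ∑ a ∈ Finset.univ.finsuppAntidiag m, finrank K (𝓜 fun j => (a j : ℤ)) =
      hilbertCoeff (fun i => (D.retract i).vars.card) (fun i => (e i).degree) m := by
  simp only [finrank_eq_card h𝓜 he]
  rw [hilbertCoeff, Finset.sum_filter, ← Finset.sum_congr rfl fun i _ =>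
    card_filter_finsuppAntidiag (e i) (D.retract i).vars m]
  exact Finset.sum_card_bipartiteAbove_eq_sum_card_bipartiteBelow _

end StanleyDecomposition

variable {K : Type u} [Field K] {n : ℕ}

theorem sum_finrank_directSumGrading {m : ℕ} (hm : m ≠ 0) :
    ∑ a ∈ Finset.univ.finsuppAntidiag m, finrank K (directSumGrading K n fun i => (a i : ℤ)) =
      2 * n.multichoose m := by
  rw [Finset.sum_congr rfl fun a ha => finrank_directSumGrading_natCast fun ha0 => hm ?_,
    Finset.sum_const, Finset.card_finsuppAntidiag_nat_eq_multichoose, Finset.card_univ,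
    Fintype.card_fin, smul_eq_mul, mul_comm]
  rw [← (mem_finsuppAntidiag_iff_degree.1 ha).1, ha0, map_zero]

theorem StanleyDecomposition.exists_multichoose_two_add_le
    (D : StanleyDecomposition (directSumGrading K n)) {d : ℕ}
    (hd : ∀ i, d ≤ (D.retract i).vars.card) :
    ∃ z, d ≤ z ∧ z ≤ n ∧ z.multichoose 2 + d * (2 * n) ≤ 2 * n.multichoose 2 + d * z := by
  choose e he using fun i => (D.gen_homogeneous i).elim fun a ha =>
    (exists_natCast_eq_of_mem_directSumGrading ha (D.gen_ne_zero i)).imp fun d hd =>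
      show D.gen i ∈ directSumGrading K n fun j => (d j : ℤ) from hd ▸ ha
  have hcoeff := sum_finrank_eq_hilbertCoeff isMultigrading_directSumGrading he
  obtain ⟨i, hi⟩ := exists_multichoose_two_add_le_hilbertCoeff (δ := fun i => (e i).degree)
    (by rw [← hcoeff, Finset.finsuppAntidiag_zero, Finset.sum_singleton]
        exact finrank_directSumGrading_zero) hd
  rw [← hcoeff, ← hcoeff, sum_finrank_directSumGrading one_ne_zero,
    sum_finrank_directSumGrading two_ne_zero, Nat.multichoose_one_right] at hi
  exact ⟨_, hd i, (Finset.card_le_univ _).trans_eq (Fintype.card_fin n), hi⟩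

theorem two_mul_multichoose_two_lt (hn : n ∈ ({1, 2, 3, 4, 5, 7, 9, 11} : Finset ℕ)) {z : ℕ}
    (hz : (n + 1) / 2 + 1 ≤ z) (hzn : z ≤ n) :
    2 * n.multichoose 2 + ((n + 1) / 2 + 1) * z <
      z.multichoose 2 + ((n + 1) / 2 + 1) * (2 * n) := by
  simp only [Nat.multichoose_eq]
  fin_cases hn <;> interval_cases z <;> decide

theorem StanleyDecomposition.depth_directSum_le
    (hn : n ∈ ({1, 2, 3, 4, 5, 7, 9, 11} : Finset ℕ))
    (D : StanleyDecomposition (directSumGrading K n)) : D.depth ≤ ((n + 1) / 2 : ℕ) := by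
  by_contra! h
  rw [D.depth_eq_iInf_card_vars] at h
  have hd (i : Fin D.size) : (n + 1) / 2 + 1 ≤ (D.retract i).vars.card := by
    exact_mod_cast h.trans_le (iInf_le _ i)
  obtain ⟨z, hz, hzn, hle⟩ := D.exists_multichoose_two_add_le hd
  exact hle.not_gt (two_mul_multichoose_two_lt hn hz hzn)

end HilbertSeries

section Decompositions

theorem iSupIndep_sumElim_map_inl_inr {R M N ι κ : Type*} [Ring R] [AddCommGroup M] [Module R M]
    [AddCommGroup N] [Module R N] {p : ι → Submodule R M} {q : κ → Submodule R N}
    (hp : iSupIndep p) (hq : iSupIndep q) :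
    iSupIndep (Sum.elim (fun i => (p i).map (LinearMap.inl R M N))
      fun j => (q j).map (LinearMap.inr R M N)) := by
  simp only [Submodule.map_inl, Submodule.map_inr]
  rintro (i | j)
  · refine Disjoint.mono_right (c := (⨆ i' ≠ i, p i').prod ⊤) (iSup₂_le fun
      | .inl i', hi' => Submodule.prod_mono
          (le_iSup₂_of_le i' (ne_of_apply_ne Sum.inl hi') le_rfl) bot_le
      | .inr j, _ => Submodule.prod_mono bot_le le_top) (disjoint_iff.2 ?_)
    rw [Sum.elim_inl, Submodule.prod_inf_prod, (hp i).eq_bot, bot_inf_eq, Submodule.prod_bot]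
  · refine Disjoint.mono_right (c := (⊤ : Submodule R M).prod (⨆ j' ≠ j, q j')) (iSup₂_le fun
      | .inl i, _ => Submodule.prod_mono le_top bot_le
      | .inr j', hj' => Submodule.prod_mono bot_le
          (le_iSup₂_of_le j' (ne_of_apply_ne Sum.inr hj') le_rfl)) (disjoint_iff.2 ?_)
    rw [Sum.elim_inr, Submodule.prod_inf_prod, (hq j).eq_bot, bot_inf_eq, Submodule.prod_bot]

theorem iSup_sumElim_map_inl_inr {R M N ι κ : Type*} [Ring R] [AddCommGroup M] [Module R M]
    [AddCommGroup N] [Module R N] {p : ι → Submodule R M} {q : κ → Submodule R N}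
    (hp : ⨆ i, p i = ⊤) (hq : ⨆ j, q j = ⊤) :
    ⨆ x, Sum.elim (fun i => (p i).map (LinearMap.inl R M N))
      (fun j => (q j).map (LinearMap.inr R M N)) x = ⊤ := by
  simp only [iSup_sum, Sum.elim_inl, Sum.elim_inr, ← Submodule.map_iSup, hp, hq, Submodule.map_top,
    LinearMap.sup_range_inl_inr]

theorem iSupIndep_of_map {R M N ι : Type*} [Ring R] [AddCommGroup M] [Module R M] [AddCommGroup N]
    [Module R N] {f : M →ₗ[R] N} (hf : Function.Injective f) {p : ι → Submodule R M}
    (hp : iSupIndep fun i => (p i).map f) : iSupIndep p := by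
  simpa only [Submodule.comap_map_eq_of_injective hf] using iSupIndep_comap hf hp

theorem restrictSupport_iUnion {σ k : Type*} {ι : Sort*} [CommRing k] (s : ι → Set (σ →₀ ℕ)) :
    restrictSupport k (⋃ i, s i) = ⨆ i, restrictSupport k (s i) := by
  simp only [restrictSupport_eq_span, Set.image_iUnion, Submodule.span_iUnion]

theorem iSupIndep_restrictSupport {σ k ι : Type*} [CommRing k] {s : ι → Set (σ →₀ ℕ)}
    (hs : Pairwise (Function.onFun Disjoint s)) : iSupIndep fun i => restrictSupport k (s i) := by
  intro i
  simp only [← restrictSupport_iUnion]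
  refine Submodule.disjoint_def.2 fun f hf hf' => support_eq_empty.1 ?_
  refine Finset.eq_empty_of_forall_notMem fun d hd => ?_
  obtain ⟨j, hj, hdj⟩ := Set.mem_iUnion₂.1 ((mem_restrictSupport_iff k).1 hf' hd)
  exact (hs (Ne.symm hj)).ne_of_mem ((mem_restrictSupport_iff k).1 hf hd) hdj rfl

theorem restrictScalars_idealOfVars {σ k : Type*} [CommRing k] :
    (idealOfVars σ k).restrictScalars k = restrictSupport k {0}ᶜ := by
  rw [idealOfVars_eq_restrictSupportIdeal, restrictScalars_restrictSupportIdeal]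
  congr 1
  ext d
  simp only [Set.mem_preimage, Set.mem_Ici, Nat.one_le_iff_ne_zero, ne_eq,
    Finsupp.degree_eq_zero_iff, Set.mem_compl_iff, Set.mem_singleton_iff]

theorem image_add_indicator {σ : Type*} {A B : Finset σ} (hAB : A ⊆ B) :
    (· + Finsupp.indicator A fun _ _ => 1) '' {d : σ →₀ ℕ | d.support ⊆ B} =
      Finsupp.support ⁻¹' Set.Icc A B := by
  classical
  ext c
  simp only [Set.mem_image, Set.mem_preimage, Set.mem_Icc, Set.mem_ofPred_eq,
    Finset.subset_iff, Finsupp.mem_support_iff]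
  constructor
  · rintro ⟨d, hd, rfl⟩
    simp only [Finsupp.add_apply, Finsupp.indicator_apply]
    grind
  · rintro ⟨hA, hB⟩
    refine ⟨c - Finsupp.indicator A fun _ _ => 1, fun i hi => hB fun hi0 => hi ?_,
      tsub_add_cancel_of_le fun i => ?_⟩
    · rw [Finsupp.tsub_apply, hi0, zero_tsub]
    · rw [Finsupp.indicator_apply]
      grind

variable {K : Type u} [Field K] {n : ℕ} {M : Type v} [AddCommGroup M]
  [Module (MvPolynomial (Fin n) K) M] [Module K M] [IsScalarTower K (MvPolynomial (Fin n) K) M]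
  {N : Type*} [AddCommGroup N] [Module (MvPolynomial (Fin n) K) N] [Module K N]
  [IsScalarTower K (MvPolynomial (Fin n) K) N]

theorem retractSpan_map (A : GradedRetract K n) (f : M →ₗ[MvPolynomial (Fin n) K] N) (u : M) :
    retractSpan A (f u) = (retractSpan A u).map (f.restrictScalars K) := by
  rw [retractSpan, retractSpan, ← Submodule.map_comp]
  congr 1
  exact LinearMap.ext fun r => (map_smul f r u).symm

theorem retractSpan_ofVars_monomial {A B : Finset (Fin n)} (hAB : A ⊆ B) :
    retractSpan (GradedRetract.ofVars K B)
        (monomial (Finsupp.indicator A fun _ _ => 1) 1 : MvPolynomial (Fin n) K) =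
      restrictSupport K (Finsupp.support ⁻¹' Set.Icc A B) := by
  rw [retractSpan_eq_span, GradedRetract.vars_ofVars, restrictSupport_eq_span,
    ← image_add_indicator hAB, Set.image_image]
  simp only [smul_eq_mul, monomial_mul, mul_one]

theorem retractSpan_ofVars_univ_one :
    retractSpan (GradedRetract.ofVars K (Finset.univ : Finset (Fin n)))
      (1 : MvPolynomial (Fin n) K) = ⊤ := by
  rw [retractSpan, GradedRetract.toSubmodule_subalgebra, GradedRetract.vars_ofVars]
  simp only [Finset.subset_univ, Set.ofPred_true, restrictSupport_univ]
  exact eq_top_iff.2 fun f _ => ⟨f, trivial, mul_one f⟩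

namespace StanleyDecomposition

variable {𝓜 : (Fin n → ℤ) → Submodule K M} {𝓝 : (Fin n → ℤ) → Submodule K N}

/-- The Stanley decomposition given by a family that is indexed by an arbitrary finite type. -/
noncomputable def ofFinite {ι : Type*} [Finite ι] (A : ι → GradedRetract K n) (u : ι → M)
    (hu : ∀ i, ∃ a, u i ∈ 𝓜 a) (hann : ∀ i, ∀ r ∈ (A i).subalgebra, r • u i = 0 → r = 0)
    (hindep : iSupIndep fun i => retractSpan (A i) (u i))
    (htop : ⨆ i, retractSpan (A i) (u i) = ⊤) : StanleyDecomposition 𝓜 where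
  size := Nat.card ι
  retract i := A ((Finite.equivFin ι).symm i)
  gen i := u ((Finite.equivFin ι).symm i)
  gen_homogeneous _ := hu _
  ann_eq_zero _ := hann _
  isInternal := DirectSum.isInternal_submodule_of_iSupIndep_of_iSup_eq_top
    (hindep.comp (Finite.equivFin ι).symm.injective)
    (((Finite.equivFin ι).symm.iSup_comp
      (g := fun i => retractSpan (A i) (u i))).trans htop)

theorem depth_ofFinite [Nontrivial M] {ι : Type*} [Finite ι] {A : ι → GradedRetract K n} {u : ι → M}
    {hu : ∀ i, ∃ a, u i ∈ 𝓜 a} {hann : ∀ i, ∀ r ∈ (A i).subalgebra, r • u i = 0 → r = 0}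
    {hindep : iSupIndep fun i => retractSpan (A i) (u i)}
    {htop : ⨆ i, retractSpan (A i) (u i) = ⊤} :
    (ofFinite A u hu hann hindep htop).depth = ⨅ i, ((A i).vars.card : ℕ∞) :=
  (depth_eq_iInf_card_vars _).trans
    ((Finite.equivFin ι).symm.iInf_comp (g := fun i => ((A i).vars.card : ℕ∞)))

theorem depth_le [Nontrivial M] (D : StanleyDecomposition 𝓜) : D.depth ≤ n := by
  rw [depth_eq_iInf_card_vars]
  refine (iInf_le _ ⟨0, D.size_pos⟩).trans ?_
  exact_mod_cast (Finset.card_le_univ _).trans_eq (Fintype.card_fin n)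

/-- The direct sum of Stanley decompositions of two modules. -/
noncomputable def prod (D : StanleyDecomposition 𝓜) (E : StanleyDecomposition 𝓝) :
    StanleyDecomposition fun a => (𝓜 a).prod (𝓝 a) :=
  have heq : (fun x => retractSpan (Sum.elim D.retract E.retract x)
      (Sum.elim (fun i => (D.gen i, 0)) (fun j => (0, E.gen j)) x : M × N)) =
      Sum.elim (fun i => (retractSpan (D.retract i) (D.gen i)).map (LinearMap.inl K M N))
        fun j => (retractSpan (E.retract j) (E.gen j)).map (LinearMap.inr K M N) :=
    funext <| Sum.rec (fun _ => retractSpan_map _ (LinearMap.inl _ M N) _)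
      fun _ => retractSpan_map _ (LinearMap.inr _ M N) _
  ofFinite (Sum.elim D.retract E.retract)
    (Sum.elim (fun i => (D.gen i, 0)) fun j => (0, E.gen j))
    (Sum.rec (fun i => (D.gen_homogeneous i).imp fun _ h => ⟨h, zero_mem _⟩)
      fun j => (E.gen_homogeneous j).imp fun _ h => ⟨zero_mem _, h⟩)
    (Sum.rec (fun i r hr h => D.ann_eq_zero i r hr (congrArg Prod.fst h))
      fun j r hr h => E.ann_eq_zero j r hr (congrArg Prod.snd h))
    (heq ▸ iSupIndep_sumElim_map_inl_inr D.isInternal.submodule_iSupIndep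
      E.isInternal.submodule_iSupIndep)
    ((congrArg iSup heq).trans (iSup_sumElim_map_inl_inr D.isInternal.submodule_iSup_eq_top
      E.isInternal.submodule_iSup_eq_top))

theorem depth_prod [Nontrivial M] [Nontrivial N] (D : StanleyDecomposition 𝓜)
    (E : StanleyDecomposition 𝓝) : (D.prod E).depth = D.depth ⊓ E.depth := by
  rw [prod, depth_ofFinite, iInf_sum, D.depth_eq_iInf_card_vars, E.depth_eq_iInf_card_vars]
  rfl

/-- The Stanley decomposition `R = R · 1`. -/
noncomputable def free (K : Type u) [Field K] (n : ℕ) : StanleyDecomposition (multigrading K n) :=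
  ofFinite (fun _ : Unit => GradedRetract.ofVars K Finset.univ) (fun _ => 1)
    (fun _ => ⟨_, monomial_mem_multigrading 0 1⟩) (fun _ r _ h => (mul_one r).symm.trans h)
    (iSupIndep_subsingleton _) (iSup_const.trans retractSpan_ofVars_univ_one)

theorem depth_free : (free K n).depth = n := by
  rw [free, depth_ofFinite, ciInf_const, GradedRetract.vars_ofVars, Finset.card_univ,
    Fintype.card_fin]

end StanleyDecomposition

end Decompositions

section IntervalDecomposition

variable {K : Type u} [Field K] {n : ℕ}

variable (K) in
/-- The product of the variables with index in `A`, as an element of the maximal ideal `m`. -/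
noncomputable def prodVars {A : Finset (Fin n)} (hA : A.Nonempty) : idealOfVars (Fin n) K :=
  ⟨monomial (Finsupp.indicator A fun _ _ => 1) 1, monomial_mem_idealOfVars_iff.2 fun h => by
    obtain ⟨i, hi⟩ := hA
    simpa only [Finsupp.indicator_of_mem hi, Finsupp.zero_apply, one_ne_zero] using
      DFunLike.congr_fun h i⟩

theorem prodVars_mem_maxIdealGrading {A : Finset (Fin n)} (hA : A.Nonempty) :
    ∃ a, prodVars K hA ∈ maxIdealGrading K n a :=
  ⟨_, monomial_mem_multigrading (Finsupp.indicator A fun _ _ => 1) (1 : K)⟩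

theorem eq_zero_of_smul_prodVars_eq_zero {A : Finset (Fin n)} (hA : A.Nonempty)
    {f : MvPolynomial (Fin n) K} (hf : f • prodVars K hA = 0) : f = 0 :=
  (smul_eq_zero.1 hf).resolve_right fun h =>
    one_ne_zero (monomial_eq_zero.1 (congrArg Subtype.val h))

theorem map_subtype_retractSpan_prodVars {A B : Finset (Fin n)} (hA : A.Nonempty) (hAB : A ⊆ B) :
    (retractSpan (GradedRetract.ofVars K B) (prodVars K hA)).map
        ((idealOfVars (Fin n) K).subtype.restrictScalars K) =
      restrictSupport K (Finsupp.support ⁻¹' Set.Icc A B) := by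
  rw [← retractSpan_map, ← retractSpan_ofVars_monomial hAB]
  rfl

variable {T : Set (Finset (Fin n) × Finset (Fin n))}
  (hT : IsIntervalPartition {s : Finset (Fin n) | s.Nonempty} T)

include hT

theorem iSupIndep_retractSpan_prodVars : iSupIndep fun p : T =>
    retractSpan (GradedRetract.ofVars K p.1.2) (prodVars K (hT.fst_mem p.2)) := by
  refine iSupIndep_of_map (f := (idealOfVars (Fin n) K).subtype.restrictScalars K)
    Subtype.val_injective ?_
  simp only [map_subtype_retractSpan_prodVars _ (hT.le _ (Subtype.prop _))]
  exact iSupIndep_restrictSupport fun _ _ h => (hT.pairwise_disjoint h).preimage _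

theorem iSup_retractSpan_prodVars : ⨆ p : T,
    retractSpan (GradedRetract.ofVars K p.1.2) (prodVars K (hT.fst_mem p.2)) = ⊤ := by
  refine Submodule.map_injective_of_injective
    (f := (idealOfVars (Fin n) K).subtype.restrictScalars K) Subtype.val_injective ?_
  simp only [Submodule.map_iSup, map_subtype_retractSpan_prodVars _ (hT.le _ (Subtype.prop _)),
    ← restrictSupport_iUnion, ← Set.preimage_iUnion, hT.iUnion_Icc]
  rw [Submodule.map_top, LinearMap.range_restrictScalars, Submodule.range_subtype,
    restrictScalars_idealOfVars]
  congr 1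
  ext d
  exact Finsupp.support_nonempty_iff

variable (K) in
/-- The Stanley decomposition of `m` attached to a partition of the nonempty sets of variables into
intervals `[A, B]`: the monomials `f` with `A ⊆ supp f ⊆ B` span the space `K[xᵢ : i ∈ B] ∏_{A} xᵢ`.
-/
noncomputable def intervalDecomposition : StanleyDecomposition (maxIdealGrading K n) :=
  .ofFinite (fun p : T => GradedRetract.ofVars K p.1.2) (fun p => prodVars K (hT.fst_mem p.2))
    (fun _ => prodVars_mem_maxIdealGrading _) (fun _ _ _ => eq_zero_of_smul_prodVars_eq_zero _)
    (iSupIndep_retractSpan_prodVars hT) (iSup_retractSpan_prodVars hT)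

theorem depth_intervalDecomposition [Nontrivial (idealOfVars (Fin n) K)] :
    (intervalDecomposition K hT).depth = ⨅ p : T, (p.1.2.card : ℕ∞) := by
  simp only [intervalDecomposition, StanleyDecomposition.depth_ofFinite,
    GradedRetract.vars_ofVars]

end IntervalDecomposition

section StanleyDepth

variable {K : Type u} [Field K] {n : ℕ}

theorem nontrivial_idealOfVars {σ k : Type*} [CommRing k] [Nontrivial k] [Nonempty σ] :
    Nontrivial (idealOfVars σ k) :=
  let ⟨i⟩ := ‹Nonempty σ›
  nontrivial_of_ne ⟨X i, Ideal.subset_span ⟨i, rfl⟩⟩ 0 fun h =>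
    X_ne_zero i (congrArg Subtype.val h)

namespace StanleyDecomposition

theorem depth_free_prod {M : Type v} [AddCommGroup M] [Module (MvPolynomial (Fin n) K) M]
    [Module K M] [IsScalarTower K (MvPolynomial (Fin n) K) M] [Nontrivial M]
    {𝓜 : (Fin n → ℤ) → Submodule K M} (D : StanleyDecomposition 𝓜) :
    ((free K n).prod D).depth = D.depth := by
  rw [depth_prod, depth_free, inf_eq_right]
  exact D.depth_le

theorem depth_maxIdeal_le [Nontrivial (idealOfVars (Fin n) K)]
    (hn : n ∈ ({1, 2, 3, 4, 5, 7, 9, 11} : Finset ℕ))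
    (D : StanleyDecomposition (maxIdealGrading K n)) : D.depth ≤ ((n + 1) / 2 : ℕ) :=
  D.depth_free_prod.symm.trans_le (depth_directSum_le hn _)

end StanleyDecomposition

variable (K) in
theorem exists_le_depth_maxIdeal [Nontrivial (idealOfVars (Fin n) K)]
    (hn : n ∈ ({1, 2, 3, 4, 5, 7, 9, 11} : Finset ℕ)) :
    ∃ D : StanleyDecomposition (maxIdealGrading K n), ((n + 1) / 2 : ℕ) ≤ D.depth := by
  obtain ⟨T, hT, hcard⟩ := exists_isIntervalPartition hn
  refine ⟨intervalDecomposition K hT, ?_⟩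
  rw [depth_intervalDecomposition]
  exact le_iInf fun p => by exact_mod_cast hcard p p.2

theorem isGreatest_sdepth {M : Type v} [AddCommGroup M] [Module (MvPolynomial (Fin n) K) M]
    [Module K M] [IsScalarTower K (MvPolynomial (Fin n) K) M] [Nontrivial M]
    {𝓜 : (Fin n → ℤ) → Submodule K M} {c : ℕ∞} (hle : ∀ D : StanleyDecomposition 𝓜, D.depth ≤ c)
    (hge : ∃ D : StanleyDecomposition 𝓜, c ≤ D.depth) :
    IsGreatest (stanleyDepths 𝓜) (sdepth 𝓜) ∧ sdepth 𝓜 = c := by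
  obtain ⟨D, hD⟩ := hge
  have hc : IsGreatest (stanleyDepths 𝓜) c :=
    ⟨⟨D, (hle D).antisymm hD⟩, Set.forall_mem_range.2 hle⟩
  have hs : sdepth 𝓜 = c := (if_neg (not_subsingleton M)).trans hc.csSup_eq
  exact ⟨hs ▸ hc, hs⟩

end StanleyDepth

end StanleyDepth

theorem proposition2p6 (K : Type*) [Field K] (n : ℕ)
    (hn : n ∈ ({1, 2, 3, 4, 5, 7, 9, 11} : Finset ℕ)) :
    IsGreatest (StanleyDepth.stanleyDepths (StanleyDepth.maxIdealGrading K n))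
      (StanleyDepth.sdepth (StanleyDepth.maxIdealGrading K n)) ∧
    IsGreatest (StanleyDepth.stanleyDepths (StanleyDepth.directSumGrading K n))
      (StanleyDepth.sdepth (StanleyDepth.directSumGrading K n)) ∧
    StanleyDepth.sdepth (StanleyDepth.maxIdealGrading K n) =
      StanleyDepth.sdepth (StanleyDepth.directSumGrading K n) := by
  have : Nonempty (Fin n) := Fin.pos_iff_nonempty.1 <| Nat.pos_of_ne_zero <| by
    rintro rfl
    simp at hn
  have : Nontrivial (idealOfVars (Fin n) K) := StanleyDepth.nontrivial_idealOfVars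
  obtain ⟨D, hD⟩ := StanleyDepth.exists_le_depth_maxIdeal K hn
  obtain ⟨hm, hm_eq⟩ := StanleyDepth.isGreatest_sdepth
    (StanleyDepth.StanleyDecomposition.depth_maxIdeal_le (K := K) hn) ⟨D, hD⟩
  obtain ⟨hRm, hRm_eq⟩ := StanleyDepth.isGreatest_sdepth
    (StanleyDepth.StanleyDecomposition.depth_directSum_le (K := K) hn)
    ⟨(StanleyDepth.StanleyDecomposition.free K n).prod D, hD.trans_eq D.depth_free_prod.symm⟩
  exact ⟨hm, hRm, hm_eq.trans hRm_eq.symm⟩
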